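/- Let $t_0,\chi_0,\chi_\infty,\lambda^{III}\in\mathbb C$ with $t_0\neq 0$, let $\varsigma\in\{1,-1\}$, put $\mathring\delta t=(t-t_0)/t_0$, $k=\chi_\infty+\varsigma\chi_0-1$ and $A=\varsigma(\chi_0^2-1)/(2t_0)-3t_0\lambda^{III}$. **Integral equations.** For functions $\lambda,\mu$, with $\eta=\sigma\,\delta t$, $\tau=t_0+\eta$, $S=\varsigma-\eta(\chi_0-\varsigma)/(2t_0)+\eta^2\lambda(\tau)$, let $$\Omega_\mu[\lambda,\mu](\sigma,\delta t)=\mu(\tau)\big(\varsigma\chi_0+2\eta(1-\mu(\tau))S\big),$$ $$\Omega_\xi[\lambda,\mu](\sigma,\delta t)=\varsigma\big(3(\chi_0-\varsigma)-8\chi_0\mu(\tau)-3(\chi_0-2\varsigma)t_0\lambda(\tau)\big)+3\eta t_0(2\mu(\tau)-1)\Big(2\varsigma\lambda(\tau)+\big(\tfrac{\chi_0-\varsigma}{2t_0}-\eta\lambda(\tau)\big)^2\Big)+4\eta(\mu(\tau)-1)\mu(\tau)S.$$ The two integral equations are $$(1)\quad \mu(t)=\tfrac12\Big(1-\tfrac{\varsigma(\chi_0^2-1)}{2t_0}+3t_0\lambda(t_0)\Big)+\mathring\delta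 t\Big(-\tfrac k2-\mu(t)+\int_0^1\Omega_\mu[\lambda,\mu](\sigma,t-t_0)\,d\sigma\Big),$$ $$(2)\quad \lambda(t)=\lambda(t_0)-\mathring\delta t\Big(\tfrac{k}{4t_0}+\lambda(t)-\tfrac1{3t_0}\int_0^1\big(2\Omega_\mu+\sigma^3\Omega_\xi\big)[\lambda,\mu](\sigma,t-t_0)\,d\sigma\Big).$$ **Starting polynomials.** Let $\lambda_0=\mu_0=0$, $\mu_1=\delta\mu_1=\tfrac12(1-A)-\tfrac k2\mathring\delta t$ and $$\begin{aligned}\lambda_1=\delta\lambda_1={}&\lambda^{III}-\tfrac{\chi_\infty}{4t_0}\mathring\delta t+\tfrac{\varsigma}{10}\mathring\delta t^2\Big(1-\big(\tfrac{\varsigma\chi_0(\chi_0-\varsigma)}{t_0}-3t_0\lambda^{III}\big)A\Big)\\&+k\,\mathring\delta t^2\Big(\tfrac{\varsigma\chi_0}{10t_0}-\tfrac{\mathring\delta t}{6}\big(\tfrac{(\chi_0-\varsigma)^2}{4t_0}+\tfrac{\chi_0^2-1}{3t_0}-2\varsigma t_0\lambda^{III}\big)+\tfrac{\mathring\delta t^2}{28}(\chi_0-\varsigma)A\Big)\\&+\tfrac1{36}\mathring\delta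 t^3(\chi_0-\varsigma)(A^2-1)-\tfrac14\mathring\delta t^4k^2\big(\tfrac{\varsigma}{7}-\tfrac{\mathring\delta t}{20}(\chi_0-\varsigma)\big).\end{aligned}$$ **Iteration kernels.** For functions $\hat\lambda,\hat\mu,\delta\lambda,\delta\mu$, evaluated at $\tau=t_0+\eta$, and $\hat S=\varsigma-\eta(\chi_0-\varsigma)/(2t_0)+\eta^2\hat\lambda$, let $$\begin{aligned}\delta\Omega_\mu^{(\lambda)}[\hat\mu,\delta\mu](\eta)&=-\tfrac12\eta^3\big((2\hat\mu-1)^2-1+\delta\mu^2\big),\qquad \delta\Omega_\mu^{(\mu)}[\hat\lambda,\hat\mu](\eta)=\varsigma\chi_0-2\eta(2\hat\mu-1)\hat S,\\ \delta\Omega_\xi^{(\lambda)}[\hat\lambda,\hat\mu,\delta\mu](\eta)&=-3\varsigma t_0(\chi_0-2\varsigma)+6t_0\eta(2\hat\mu-1)\hat S+4\eta^3\big(\hat\mu(\hat\mu-1)+\tfrac14\delta\mu^2\big),\\ \delta\Omega_\xi^{(\mu)}[\hat\lambda,\hat\mu,\delta\lambda](\eta)&=-8\varsigma\chi_0+\tfrac{3\eta(\chi_0-\varsigma)^2}{2t_0}+4\eta\big(2\hat\mu-1+3t_0\hat\lambda\big)\hat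 S-6\eta^3t_0\big(\hat\lambda^2-\tfrac14\delta\lambda^2\big).\end{aligned}$$ **Iteration.** For $n\ge1$, given $\lambda_{n-1},\mu_{n-1},\delta\lambda_n,\delta\mu_n$, put (with $\eta=(t-t_0)\sigma$, $\tau=t_0+\eta$): 1. $\lambda_n=\lambda_{n-1}+\delta\lambda_n$, $\mu_n=\mu_{n-1}+\delta\mu_n$, $\lambda_{n-1/2}=\tfrac12(\lambda_n+\lambda_{n-1})$, $\mu_{n-1/2}=\tfrac12(\mu_n+\mu_{n-1})$; 2. $\delta\mu_{n+1}(t)=\mathring\delta t\Big(-\delta\mu_n(t)+\int_0^1\big(\delta\mu_n(\tau)\,\delta\Omega_\mu^{(\mu)}[\lambda_{n-1/2},\mu_{n-1/2}](\eta)+\delta\lambda_n(\tau)\,\delta\Omega_\mu^{(\lambda)}[\mu_{n-1/2},\delta\mu_n](\eta)\big)d\sigma\Big)$; 3. $\mu_{n+1}=\mu_n+\delta\mu_{n+1}$, $\mu_{n+1/2}=\tfrac12(\mu_{n+1}+\mu_n)$; 4. $\delta\lambda_{n+1}(t)=\mathring\delta t\Big(-\delta\lambda_n(t)+\tfrac{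2}{3t_0}\int_0^1\big(\delta\mu_{n+1}(\tau)\,\delta\Omega_\mu^{(\mu)}[\lambda_{n-1/2},\mu_{n+1/2}](\eta)+\delta\lambda_n(\tau)\,\delta\Omega_\mu^{(\lambda)}[\mu_{n+1/2},\delta\mu_{n+1}](\eta)\big)d\sigma+\tfrac1{3t_0}\int_0^1\sigma^3\big(\delta\mu_{n+1}(\tau)\,\delta\Omega_\xi^{(\mu)}[\lambda_{n-1/2},\mu_{n+1/2},\delta\lambda_n](\eta)+\delta\lambda_n(\tau)\,\delta\Omega_\xi^{(\lambda)}[\lambda_{n-1/2},\mu_{n+1/2},\delta\mu_{n+1}](\eta)\big)d\sigma\Big)$; 5. $\lambda_{n+1}=\lambda_n+\delta\lambda_{n+1}$. **Constants.** Let $\alpha\in(0,1)$ and $U=\{t:|t-t_0|<|t_0|\alpha\}$. Let $M^{(\lambda)}=\max(1,2\sup_U|\lambda_1|)$ and $M^{(\mu)}=\max(1,2\sup_U|\mu_1|)$. For each of the four kernels let $B_\mu^{(\lambda)},B_\mu^{(\mu)},B_\xi^{(\lambda)},B_\xi^{(\mu)}$ be the maximum of $1$ and the supremum of $|\delta\Omega^{(\cdot)}_{\cdot}[\cdots](t-t_0)|$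 over all $t\in U$ and all holomorphic $\hat\lambda,\hat\mu,\delta\lambda,\delta\mu$ on $U$ with $|\hat\lambda|\le M^{(\lambda)}$, $|\hat\mu|\le M^{(\mu)}$, $|\delta\lambda|\le2M^{(\lambda)}$, $|\delta\mu|\le2M^{(\mu)}$ on $U$. Let $$Q_1=1+B_\mu^{(\mu)}+B_\mu^{(\lambda)}\frac{M^{(\lambda)}}{M^{(\mu)}},\qquad Q_2=1+\frac{2B_\mu^{(\lambda)}+B_\xi^{(\lambda)}/\sqrt7}{3|t_0|}+\frac{2B_\mu^{(\mu)}/\sqrt3+B_\xi^{(\mu)}/3}{6|t_0|}\cdot\frac{M^{(\mu)}}{M^{(\lambda)}},$$ $\beta=\max(Q_1,Q_2)$ and $\tilde\alpha=\min(\alpha,1/(2\beta))$. **Theorem.** $\tilde\alpha>0$, all $\lambda_n,\mu_n,\delta\lambda_n,\delta\mu_n$ are polynomials in $t$, and the sequences $\lambda_n$, $\mu_n$ converge uniformly on the disc $\tilde U=\{t:|t-t_0|<|t_0|\tilde\alpha\}$ to functions $\lambda,\mu$ which are holomorphic on $\tilde U$ and satisfy the integral equations (1) and (2) at every $t\in\tilde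 U$. -/

import Mathlib

noncomputable section

namespace PainleveRoot

/-- The data of the problem: the base point `t₀`, the constants `χ₀`, `χ_∞` of the third Painlevé
equation, the constant `lamIII` (prescribed value of `lam` at `t₀`), and the sign switch `sgn`. -/
structure Params where
  t0 : ℂ
  chi0 : ℂ
  chiInf : ℂ
  lamIII : ℂ
  sgn : ℂ

/-! ### The integral equations -/

/-- The kernel `Ω_μ[lam, mu](σ, δt)`, where `τ = t₀ + δt σ`. -/
def OmegaMu (p : Params) (lam mu : ℂ → ℂ) (σ : ℝ) (δt : ℂ) : ℂ :=
  let η : ℂ := δt * σ;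
  let τ : ℂ := p.t0 + η;
  mu τ * (p.sgn * p.chi0 + 2 * η * (1 - mu τ) *
    (p.sgn - η * (p.chi0 - p.sgn) / (2 * p.t0) + η ^ 2 * lam τ))

/-- The kernel `Ω_ξ[lam, mu](σ, δt)`, where `τ = t₀ + δt σ`. -/
def OmegaXi (p : Params) (lam mu : ℂ → ℂ) (σ : ℝ) (δt : ℂ) : ℂ :=
  let η : ℂ := δt * σ;
  let τ : ℂ := p.t0 + η;
  p.sgn * (3 * (p.chi0 - p.sgn) - 8 * p.chi0 * mu τ
      - 3 * (p.chi0 - 2 * p.sgn) * p.t0 * lam τ)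
    + 3 * η * p.t0 * (2 * mu τ - 1) *
      (2 * p.sgn * lam τ + ((p.chi0 - p.sgn) / (2 * p.t0) - η * lam τ) ^ 2)
    + 4 * η * (mu τ - 1) * mu τ *
      (p.sgn - η * (p.chi0 - p.sgn) / (2 * p.t0) + η ^ 2 * lam τ)

/-- The kernel of the refined integral equation for `lam`. -/
def OmegaLamArc (p : Params) (lam mu : ℂ → ℂ) (σ : ℝ) (δt : ℂ) : ℂ :=
  2 * OmegaMu p lam mu σ δt + (σ : ℂ) ^ 3 * OmegaXi p lam mu σ δt

/-- The integral equation for `mu`, at the point `t`. -/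
def MuEquation (p : Params) (lam mu : ℂ → ℂ) (t : ℂ) : Prop :=
  mu t = (1 - p.sgn * (p.chi0 ^ 2 - 1) / (2 * p.t0) + 3 * p.t0 * lam p.t0) / 2
    + (t - p.t0) / p.t0 *
      (-(p.chiInf + p.sgn * p.chi0 - 1) / 2 - mu t
        + ∫ σ in (0 : ℝ)..1, OmegaMu p lam mu σ (t - p.t0))

/-- The refined integral equation for `lam`, at the point `t`. -/
def LamEquation (p : Params) (lam mu : ℂ → ℂ) (t : ℂ) : Prop :=
  lam t = lam p.t0 - (t - p.t0) / p.t0 *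
      ((p.chiInf + p.sgn * p.chi0 - 1) / (4 * p.t0) + lam t
        - 1 / (3 * p.t0) * ∫ σ in (0 : ℝ)..1, OmegaLamArc p lam mu σ (t - p.t0))

/-! ### The kernels of the iteration for the increments -/

/-- Coefficient of `δlam` in the increment of `Ω_μ`. -/
def dOmegaMuLam (p : Params) (muHat dmu : ℂ → ℂ) (η : ℂ) : ℂ :=
  let τ : ℂ := p.t0 + η;
  -(η ^ 3 / 2) * ((2 * muHat τ - 1) ^ 2 - 1 + dmu τ ^ 2)

/-- Coefficient of `δmu` in the increment of `Ω_μ`. -/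
def dOmegaMuMu (p : Params) (lamHat muHat : ℂ → ℂ) (η : ℂ) : ℂ :=
  let τ : ℂ := p.t0 + η;
  p.sgn * p.chi0 - 2 * η * (2 * muHat τ - 1) *
    (p.sgn - η * (p.chi0 - p.sgn) / (2 * p.t0) + η ^ 2 * lamHat τ)

/-- Coefficient of `δlam` in the increment of `Ω_ξ`. -/
def dOmegaXiLam (p : Params) (lamHat muHat dmu : ℂ → ℂ) (η : ℂ) : ℂ :=
  let τ : ℂ := p.t0 + η;
  -3 * p.sgn * p.t0 * (p.chi0 - 2 * p.sgn)
    + 6 * p.t0 * η * (2 * muHat τ - 1) *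
      (p.sgn - η * (p.chi0 - p.sgn) / (2 * p.t0) + η ^ 2 * lamHat τ)
    + 4 * η ^ 3 * (muHat τ * (muHat τ - 1) + dmu τ ^ 2 / 4)

/-- Coefficient of `δmu` in the increment of `Ω_ξ`. -/
def dOmegaXiMu (p : Params) (lamHat muHat dlam : ℂ → ℂ) (η : ℂ) : ℂ :=
  let τ : ℂ := p.t0 + η;
  -8 * p.sgn * p.chi0 + 3 * η * (p.chi0 - p.sgn) ^ 2 / (2 * p.t0)
    + 4 * η * (2 * muHat τ - 1 + 3 * p.t0 * lamHat τ) *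
      (p.sgn - η * (p.chi0 - p.sgn) / (2 * p.t0) + η ^ 2 * lamHat τ)
    - 6 * η ^ 3 * p.t0 * (lamHat τ ^ 2 - dlam τ ^ 2 / 4)

/-! ### The starting polynomials -/

/-- The polynomial `μ₁`. -/
def mu1 (p : Params) (t : ℂ) : ℂ :=
  let d : ℂ := (t - p.t0) / p.t0;
  (1 - p.sgn * (p.chi0 ^ 2 - 1) / (2 * p.t0) + 3 * p.t0 * p.lamIII) / 2
    - d * (p.chiInf + p.sgn * p.chi0 - 1) / 2

/-- The polynomial `λ₁`. -/
def lam1 (p : Params) (t : ℂ) : ℂ :=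
  let d : ℂ := (t - p.t0) / p.t0;
  p.lamIII - d * p.chiInf / (4 * p.t0)
    + d ^ 2 * p.sgn *
      (1 - (p.sgn * p.chi0 * (p.chi0 - p.sgn) / p.t0 - 3 * p.t0 * p.lamIII) *
        (p.sgn * (p.chi0 ^ 2 - 1) / (2 * p.t0) - 3 * p.t0 * p.lamIII)) / 10
    + d ^ 2 * (p.chiInf + p.sgn * p.chi0 - 1) *
      (p.sgn * p.chi0 / (10 * p.t0)
        - d * ((p.chi0 - p.sgn) ^ 2 / (4 * p.t0) + (p.chi0 ^ 2 - 1) / (3 * p.t0)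
            - 2 * p.sgn * p.t0 * p.lamIII) / 6
        + d ^ 2 * (p.chi0 - p.sgn) *
          (p.sgn * (p.chi0 ^ 2 - 1) / (2 * p.t0) - 3 * p.t0 * p.lamIII) / 28)
    + d ^ 3 * (p.chi0 - p.sgn) *
      ((p.sgn * (p.chi0 ^ 2 - 1) / (2 * p.t0) - 3 * p.t0 * p.lamIII) ^ 2 - 1) / 36
    - d ^ 4 * (p.chiInf + p.sgn * p.chi0 - 1) ^ 2 *
      (p.sgn / 7 - d * (p.chi0 - p.sgn) / 20) / 4

/-! ### The iteration -/

/-- The quadruple `λ_{n-1}, μ_{n-1}, δλ_n, δμ_n` handled by one step of the iteration. -/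
structure Quad where
  lam : ℂ → ℂ
  mu : ℂ → ℂ
  dlam : ℂ → ℂ
  dmu : ℂ → ℂ

/-- The new increment `δμ_{n+1}`, given `λ_{n-1/2}`, `μ_{n-1/2}`, `δλ_n`, `δμ_n`. -/
def nextDmu (p : Params) (lamHalf muHalf dlam dmu : ℂ → ℂ) (t : ℂ) : ℂ :=
  (t - p.t0) / p.t0 *
    (-dmu t + ∫ σ in (0 : ℝ)..1,
      let η : ℂ := (t - p.t0) * σ;
      dmu (p.t0 + η) * dOmegaMuMu p lamHalf muHalf η
        + dlam (p.t0 + η) * dOmegaMuLam p muHalf dmu η)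

/-- The new increment `δλ_{n+1}`, given `λ_{n-1/2}`, `μ_{n+1/2}`, `δλ_n`, `δμ_{n+1}`. -/
def nextDlam (p : Params) (lamHalf muHalf dlam dmu : ℂ → ℂ) (t : ℂ) : ℂ :=
  (t - p.t0) / p.t0 *
    (-dlam t
      + 2 / (3 * p.t0) * (∫ σ in (0 : ℝ)..1,
          let η : ℂ := (t - p.t0) * σ;
          dmu (p.t0 + η) * dOmegaMuMu p lamHalf muHalf η
            + dlam (p.t0 + η) * dOmegaMuLam p muHalf dmu η)
      + 1 / (3 * p.t0) * (∫ σ in (0 : ℝ)..1,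
          let η : ℂ := (t - p.t0) * σ;
          (σ : ℂ) ^ 3 * (dmu (p.t0 + η) * dOmegaXiMu p lamHalf muHalf dlam η
            + dlam (p.t0 + η) * dOmegaXiLam p lamHalf muHalf dmu η)))

/-- One step of the iteration:
`(λ_{n-1}, μ_{n-1}, δλ_n, δμ_n) ↦ (λ_n, μ_n, δλ_{n+1}, δμ_{n+1})`. -/
def step (p : Params) (q : Quad) : Quad :=
  let lamN : ℂ → ℂ := fun t => q.lam t + q.dlam t;
  let muN : ℂ → ℂ := fun t => q.mu t + q.dmu t;
  let lamHalf : ℂ → ℂ := fun t => (lamN t + q.lam t) / 2;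
  let muHalf : ℂ → ℂ := fun t => (muN t + q.mu t) / 2;
  let dmuNext : ℂ → ℂ := nextDmu p lamHalf muHalf q.dlam q.dmu;
  let muNext : ℂ → ℂ := fun t => muN t + dmuNext t;
  let muHalfNext : ℂ → ℂ := fun t => (muNext t + muN t) / 2;
  { lam := lamN
    mu := muN
    dlam := nextDlam p lamHalf muHalfNext q.dlam dmuNext
    dmu := dmuNext }

/-- The quadruple `(λ_n, μ_n, δλ_{n+1}, δμ_{n+1})`, starting from `(0, 0, λ₁, μ₁)` at `n = 0`. -/
def quad (p : Params) : ℕ → Quad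
  | 0 => { lam := fun _ => 0, mu := fun _ => 0, dlam := lam1 p, dmu := mu1 p }
  | n + 1 => step p (quad p n)

/-- `λ_n`. -/
def lamSeq (p : Params) (n : ℕ) : ℂ → ℂ := (quad p n).lam

/-- `μ_n`. -/
def muSeq (p : Params) (n : ℕ) : ℂ → ℂ := (quad p n).mu

/-- `f` is a polynomial function. -/
def IsPolynomialFun (f : ℂ → ℂ) : Prop :=
  ∃ P : Polynomial ℂ, ∀ t, f t = P.eval t

/-! ### The constants -/

/-- The disc `|t - t₀| < |t₀| a`. -/
def disc (p : Params) (a : ℝ) : Set ℂ := Metric.ball p.t0 (‖p.t0‖ * a)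

def Mlam (p : Params) (α : ℝ) : ℝ :=
  max 1 (2 * sSup ((fun t => ‖lam1 p t‖) '' disc p α))

def Mmu (p : Params) (α : ℝ) : ℝ :=
  max 1 (2 * sSup ((fun t => ‖mu1 p t‖) '' disc p α))

/-- `f` is regular on the disc and bounded there by `M`. -/
def RegularBounded (p : Params) (α M : ℝ) (f : ℂ → ℂ) : Prop :=
  DifferentiableOn ℂ f (disc p α) ∧ ∀ t ∈ disc p α, ‖f t‖ ≤ M

/-- The maximum of `1` and of the supremum of `‖K[lamHat, muHat, dlam, dmu](t - t₀)‖` over `t` in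
the disc and over the regular functions with `|lamHat| ≤ M^λ`, `|muHat| ≤ M^μ`, `|dlam| ≤ 2 M^λ`,
`|dmu| ≤ 2 M^μ` on the disc. -/
def kernelBound (p : Params) (α : ℝ)
    (K : (ℂ → ℂ) → (ℂ → ℂ) → (ℂ → ℂ) → (ℂ → ℂ) → ℂ → ℂ) : ℝ :=
  max 1 (sSup {r : ℝ | ∃ lamHat muHat dlam dmu : ℂ → ℂ,
    RegularBounded p α (Mlam p α) lamHat ∧ RegularBounded p α (Mmu p α) muHat ∧
    RegularBounded p α (2 * Mlam p α) dlam ∧ RegularBounded p α (2 * Mmu p α) dmu ∧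
    ∃ t ∈ disc p α, r = ‖K lamHat muHat dlam dmu (t - p.t0)‖})

def BMuLam (p : Params) (α : ℝ) : ℝ :=
  kernelBound p α fun _ muHat _ dmu => dOmegaMuLam p muHat dmu

def BMuMu (p : Params) (α : ℝ) : ℝ :=
  kernelBound p α fun lamHat muHat _ _ => dOmegaMuMu p lamHat muHat

def BXiLam (p : Params) (α : ℝ) : ℝ :=
  kernelBound p α fun lamHat muHat _ dmu => dOmegaXiLam p lamHat muHat dmu

def BXiMu (p : Params) (α : ℝ) : ℝ :=
  kernelBound p α fun lamHat muHat dlam _ => dOmegaXiMu p lamHat muHat dlam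

def Q1 (p : Params) (α : ℝ) : ℝ :=
  1 + BMuMu p α + BMuLam p α * Mlam p α / Mmu p α

def Q2 (p : Params) (α : ℝ) : ℝ :=
  1 + (2 * BMuLam p α + BXiLam p α / √7) / (3 * ‖p.t0‖)
    + (2 * BMuMu p α / √3 + BXiMu p α / 3) / (6 * ‖p.t0‖) * Mmu p α / Mlam p α

def beta (p : Params) (α : ℝ) : ℝ := max (Q1 p α) (Q2 p α)

def alphaTilde (p : Params) (α : ℝ) : ℝ := min α (1 / (2 * beta p α))

end PainleveRoot

end

/-!
The right-hand sides of the two integral equations, with `lam t₀` replaced by the constant `lamIII`,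
are maps `muMap` and `lamMap` of `(lam, mu)`, and the iteration is a Gauss-Seidel fixed-point
iteration for them: `μ_{n+1} = muMap (λ_n, μ_n)`, `λ_{n+1} = lamMap (λ_n, μ_{n+1})`, see
`seq_succ_eq_map`. This is because the kernels `Ω_μ`, `Ω_ξ` have such low degree that their
difference at two arguments is given exactly by the kernels `dOmega` at the midpoint
(`OmegaMu_add_sub`, `OmegaXi_add_sub`), and because `μ₁`, `λ₁` are the first iterates of zero
(`mu1_eq_muMap`, `lam1_eq_lamMap`).

On the small disc the increments satisfy `|δμ_n| ≤ 2⁻ⁿ Mmu`, `|δλ_n| ≤ 2⁻ⁿ Mlam`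
(`norm_quad_le`): then all iterates and midpoints stay below `Mmu`, `Mlam`, so that the kernels are
bounded by the constants `B`, and one step multiplies the increments by at most
`|t - t₀| / |t₀| * Q` with `Q = Q1` or `Q = Q2`, which is at most `1 / 2` by the choice of
`alphaTilde` (`norm_nextDmu_le`, `norm_nextDlam_le`).

The sequences therefore converge uniformly to holomorphic functions. By dominated convergence the
fixed-point relations pass to the limit, and every `λ_n` with `n ≥ 1` has the value `lamIII` at `t₀`.
-/

noncomputable section

namespace PainleveRoot

/-! ### The integral equations as a fixed-point problem -/

/-- The right-hand side of the integral equation for `mu`, with the value of `lam` at `t₀` replaced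
by the constant `lamIII`. -/
def muMap (p : Params) (lam mu : ℂ → ℂ) (t : ℂ) : ℂ :=
  (1 - p.sgn * (p.chi0 ^ 2 - 1) / (2 * p.t0) + 3 * p.t0 * p.lamIII) / 2
    + (t - p.t0) / p.t0 *
      (-(p.chiInf + p.sgn * p.chi0 - 1) / 2 - mu t
        + ∫ σ in (0 : ℝ)..1, OmegaMu p lam mu σ (t - p.t0))

/-- The right-hand side of the integral equation for `lam`, with the value of `lam` at `t₀` replaced
by the constant `lamIII`. -/
def lamMap (p : Params) (lam mu : ℂ → ℂ) (t : ℂ) : ℂ :=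
  p.lamIII - (t - p.t0) / p.t0 *
      ((p.chiInf + p.sgn * p.chi0 - 1) / (4 * p.t0) + lam t
        - 1 / (3 * p.t0) * ∫ σ in (0 : ℝ)..1, OmegaLamArc p lam mu σ (t - p.t0))

lemma integral_sum_range_mul_pow (n : ℕ) (c : ℕ → ℂ) :
    ∫ σ in (0 : ℝ)..1, ∑ i ∈ Finset.range n, c i * (σ : ℂ) ^ i
      = ∑ i ∈ Finset.range n, c i / (i + 1) := by
  rw [intervalIntegral.integral_finsetSum]
  · refine Finset.sum_congr rfl fun i _ => ?_
    rw [intervalIntegral.integral_const_mul]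
    have : ∫ σ in (0 : ℝ)..1, (σ : ℂ) ^ i = ((∫ σ in (0 : ℝ)..1, σ ^ i : ℝ) : ℂ) := by
      rw [← intervalIntegral.integral_ofReal]; simp
    rw [this, integral_pow]
    push_cast
    simp [div_eq_mul_inv]
  · intro i _
    exact (by fun_prop : Continuous fun σ : ℝ => c i * (σ : ℂ) ^ i).intervalIntegrable _ _

lemma mu1_eq_muMap (p : Params) (t : ℂ) :
    mu1 p t = muMap p (fun _ => 0) (fun _ => 0) t := by
  simp [mu1, muMap, OmegaMu]
  ring

/-- The explicit polynomial `λ₁` is the result of inserting `lam = 0`, `mu = μ₁` into the right-hand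
side of the integral equation for `lam`. Here `mu` is affine in `σ` on the ray from `t₀` to `t`, so
that the integrand is a polynomial of degree `7` in `σ`. -/
lemma lam1_eq_lamMap (p : Params) (ht0 : p.t0 ≠ 0) (hsgn : p.sgn ^ 2 = 1) (t : ℂ) :
    lam1 p t = lamMap p (fun _ => 0) (mu1 p) t := by
  obtain ⟨t0, chi0, chiInf, lamIII, s⟩ := p
  simp only at ht0 hsgn
  obtain ⟨d, rfl⟩ : ∃ d, t = t0 + t0 * d := ⟨(t - t0) / t0, by field_simp; ring⟩
  have hd : (t0 + t0 * d - t0) / t0 = d := by field_simp; ring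
  -- `mu1 (t₀ + t₀ d σ) = a + b σ`, and `g₀ + g₁ σ + g₂ σ²` is `mu1 (1 - mu1)`.
  set a : ℂ := (1 - s * (chi0 ^ 2 - 1) / (2 * t0) + 3 * t0 * lamIII) / 2 with ha
  set b : ℂ := -(chiInf + s * chi0 - 1) / 2 * d with hb
  set e : ℂ := (chi0 - s) / (2 * t0) with he
  let g0 : ℂ := a * (1 - a)
  let g1 : ℂ := b * (1 - 2 * a)
  let g2 : ℂ := -b ^ 2
  let w : ℂ := t0 * d
  let c : ℕ → ℂ := fun i => match i with
    | 0 => 2 * s * chi0 * a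
    | 1 => 2 * s * chi0 * b + 4 * w * s * g0
    | 2 => 4 * w * (s * g1 - w * e * g0)
    | 3 => 4 * w * (s * g2 - w * e * g1) + 3 * s * (chi0 - s) - 8 * s * chi0 * a
    | 4 => -4 * w * (w * e * g2) - 8 * s * chi0 * b + 3 * w * t0 * e ^ 2 * (2 * a - 1)
        - 4 * w * s * g0
    | 5 => 6 * w * t0 * e ^ 2 * b - 4 * w * (s * g1 - w * e * g0)
    | 6 => -4 * w * (s * g2 - w * e * g1)
    | _ => 4 * w * (w * e * g2)
  have hmu : ∀ σ : ℂ, mu1 ⟨t0, chi0, chiInf, lamIII, s⟩ (t0 + (t0 + t0 * d - t0) * σ)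
      = a + b * σ := by
    intro σ
    simp only [mu1, ha, hb]
    field_simp
    ring
  have hint : ∀ σ : ℝ, OmegaLamArc ⟨t0, chi0, chiInf, lamIII, s⟩ (fun _ => 0)
      (mu1 ⟨t0, chi0, chiInf, lamIII, s⟩) σ (t0 + t0 * d - t0)
      = ∑ i ∈ Finset.range 8, c i * (σ : ℂ) ^ i := by
    intro σ
    simp only [OmegaLamArc, OmegaMu, OmegaXi, hmu, Finset.sum_range_succ, Finset.sum_range_zero, c,
      g0, g1, g2, w]
    rw [mul_div_assoc, ← he]
    ring
  simp only [lamMap, hint, integral_sum_range_mul_pow, hd]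
  simp only [lam1, hd, Finset.sum_range_succ, Finset.sum_range_zero, c, g0, g1, g2, w]
  clear hint hmu hd c
  rw [ha, hb, he]
  clear_value a b e
  push_cast
  rcases sq_eq_one_iff.mp hsgn with rfl | rfl
  · field_simp
    ring
  · field_simp
    ring

/-! ### Polynomial functions -/

attribute [local fun_prop] IsPolynomialFun

namespace IsPolynomialFun

@[fun_prop]
lemma id' : IsPolynomialFun fun t => t := ⟨Polynomial.X, by simp⟩

@[fun_prop]
lemma const (c : ℂ) : IsPolynomialFun fun _ => c := ⟨Polynomial.C c, by simp⟩

variable {f g : ℂ → ℂ}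

@[fun_prop]
lemma comp (hf : IsPolynomialFun f) (hg : IsPolynomialFun g) :
    IsPolynomialFun fun t => f (g t) := by
  obtain ⟨P, hP⟩ := hf
  obtain ⟨Q, hQ⟩ := hg
  exact ⟨P.comp Q, by simp [hP, hQ]⟩

@[fun_prop]
lemma add (hf : IsPolynomialFun f) (hg : IsPolynomialFun g) :
    IsPolynomialFun fun t => f t + g t := by
  obtain ⟨P, hP⟩ := hf
  obtain ⟨Q, hQ⟩ := hg
  exact ⟨P + Q, by simp [hP, hQ]⟩

@[fun_prop]
lemma mul (hf : IsPolynomialFun f) (hg : IsPolynomialFun g) :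
    IsPolynomialFun fun t => f t * g t := by
  obtain ⟨P, hP⟩ := hf
  obtain ⟨Q, hQ⟩ := hg
  exact ⟨P * Q, by simp [hP, hQ]⟩

@[fun_prop]
lemma neg (hf : IsPolynomialFun f) : IsPolynomialFun fun t => -f t := by
  obtain ⟨P, hP⟩ := hf
  exact ⟨-P, by simp [hP]⟩

@[fun_prop]
lemma sub (hf : IsPolynomialFun f) (hg : IsPolynomialFun g) :
    IsPolynomialFun fun t => f t - g t := by
  simpa only [sub_eq_add_neg] using hf.add hg.neg

@[fun_prop]
lemma div_const (hf : IsPolynomialFun f) (c : ℂ) : IsPolynomialFun fun t => f t / c := by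
  simpa only [div_eq_mul_inv] using hf.mul (const c⁻¹)

@[fun_prop]
lemma pow (hf : IsPolynomialFun f) (n : ℕ) : IsPolynomialFun fun t => f t ^ n := by
  obtain ⟨P, hP⟩ := hf
  exact ⟨P ^ n, by simp [hP]⟩

protected lemma differentiable (hf : IsPolynomialFun f) : Differentiable ℂ f := by
  obtain ⟨P, hP⟩ := hf
  rw [funext hP]
  exact P.differentiable

protected lemma continuous (hf : IsPolynomialFun f) : Continuous f := hf.differentiable.continuous

lemma integral_pow_mul (hf : IsPolynomialFun f) (t0 : ℂ) (j : ℕ) :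
    IsPolynomialFun fun t => ∫ σ in (0 : ℝ)..1, (σ : ℂ) ^ j * f ((t - t0) * σ) := by
  obtain ⟨P, hP⟩ := hf
  have h : ∀ t : ℂ, ∫ σ in (0 : ℝ)..1, (σ : ℂ) ^ j * f ((t - t0) * σ)
      = ∑ i ∈ Finset.range (P.natDegree + 1),
        P.coeff i * (∫ σ in (0 : ℝ)..1, (σ : ℂ) ^ (j + i)) * (t - t0) ^ i := by
    intro t
    simp only [hP, Polynomial.eval_eq_sum_range, Finset.mul_sum]
    rw [intervalIntegral.integral_finsetSum]
    · refine Finset.sum_congr rfl fun i _ => ?_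
      rw [mul_right_comm, ← intervalIntegral.integral_const_mul]
      simp only [mul_pow, pow_add]
      congr 1
      ext σ
      ring
    · intro i _
      exact (by fun_prop : Continuous fun σ : ℝ =>
        (σ : ℂ) ^ j * (P.coeff i * ((t - t0) * σ) ^ i)).intervalIntegrable _ _
  refine ⟨∑ i ∈ Finset.range (P.natDegree + 1),
    Polynomial.C (P.coeff i * ∫ σ in (0 : ℝ)..1, (σ : ℂ) ^ (j + i))
      * (Polynomial.X - Polynomial.C t0) ^ i, fun t => ?_⟩
  refine (h t).trans ?_
  simp [Polynomial.eval_finsetSum]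

lemma integral (hf : IsPolynomialFun f) (t0 : ℂ) :
    IsPolynomialFun fun t => ∫ σ in (0 : ℝ)..1, f ((t - t0) * σ) := by
  simpa using hf.integral_pow_mul t0 0

end IsPolynomialFun

variable {p : Params} {lam mu dlam dmu : ℂ → ℂ}

lemma isPolynomialFun_mu1 (p : Params) : IsPolynomialFun (mu1 p) := by
  unfold mu1
  fun_prop

lemma isPolynomialFun_lam1 (p : Params) : IsPolynomialFun (lam1 p) := by
  unfold lam1
  fun_prop

lemma isPolynomialFun_muIntegrand (hlam : IsPolynomialFun lam) (hmu : IsPolynomialFun mu)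
    (hdlam : IsPolynomialFun dlam) (hdmu : IsPolynomialFun dmu) :
    IsPolynomialFun fun η => dmu (p.t0 + η) * dOmegaMuMu p lam mu η
      + dlam (p.t0 + η) * dOmegaMuLam p mu dmu η := by
  simp only [dOmegaMuMu, dOmegaMuLam]
  fun_prop

lemma isPolynomialFun_xiIntegrand (hlam : IsPolynomialFun lam) (hmu : IsPolynomialFun mu)
    (hdlam : IsPolynomialFun dlam) (hdmu : IsPolynomialFun dmu) :
    IsPolynomialFun fun η => dmu (p.t0 + η) * dOmegaXiMu p lam mu dlam η
      + dlam (p.t0 + η) * dOmegaXiLam p lam mu dmu η := by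
  simp only [dOmegaXiMu, dOmegaXiLam]
  fun_prop

lemma isPolynomialFun_nextDmu (hlam : IsPolynomialFun lam) (hmu : IsPolynomialFun mu)
    (hdlam : IsPolynomialFun dlam) (hdmu : IsPolynomialFun dmu) :
    IsPolynomialFun (nextDmu p lam mu dlam dmu) := by
  have h := (isPolynomialFun_muIntegrand (p := p) hlam hmu hdlam hdmu).integral p.t0
  unfold nextDmu
  fun_prop

lemma isPolynomialFun_nextDlam (hlam : IsPolynomialFun lam) (hmu : IsPolynomialFun mu)
    (hdlam : IsPolynomialFun dlam) (hdmu : IsPolynomialFun dmu) :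
    IsPolynomialFun (nextDlam p lam mu dlam dmu) := by
  have h := (isPolynomialFun_muIntegrand (p := p) hlam hmu hdlam hdmu).integral p.t0
  have h' := (isPolynomialFun_xiIntegrand (p := p) hlam hmu hdlam hdmu).integral_pow_mul p.t0 3
  unfold nextDlam
  fun_prop

lemma isPolynomialFun_quad (p : Params) (n : ℕ) :
    IsPolynomialFun (quad p n).lam ∧ IsPolynomialFun (quad p n).mu ∧
      IsPolynomialFun (quad p n).dlam ∧ IsPolynomialFun (quad p n).dmu := by
  induction n with
  | zero => exact ⟨.const 0, .const 0, isPolynomialFun_lam1 p, isPolynomialFun_mu1 p⟩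
  | succ n ih =>
    obtain ⟨hlam, hmu, hdlam, hdmu⟩ := ih
    have hnext : IsPolynomialFun (quad p (n + 1)).dmu :=
      isPolynomialFun_nextDmu (by fun_prop) (by fun_prop) hdlam hdmu
    refine ⟨hlam.add hdlam, hmu.add hdmu, ?_, hnext⟩
    exact isPolynomialFun_nextDlam (by fun_prop)
      ((((hmu.add hdmu).add hnext).add (hmu.add hdmu)).div_const 2) hdlam hnext

/-! ### The increments are differences of successive iterates -/

/-- The kernel `Ω_μ` is polynomial in `lam` and `mu` of so low degree that its increment is an exact
expression in the midpoint values. -/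
lemma OmegaMu_add_sub (p : Params) (lam mu dlam dmu : ℂ → ℂ) (σ : ℝ) (δ : ℂ) :
    OmegaMu p (fun t => lam t + dlam t) (fun t => mu t + dmu t) σ δ - OmegaMu p lam mu σ δ
      = dmu (p.t0 + δ * σ) * dOmegaMuMu p (fun t => (lam t + dlam t + lam t) / 2)
          (fun t => (mu t + dmu t + mu t) / 2) (δ * σ)
        + dlam (p.t0 + δ * σ) * dOmegaMuLam p (fun t => (mu t + dmu t + mu t) / 2) dmu (δ * σ) := by
  simp only [OmegaMu, dOmegaMuMu, dOmegaMuLam]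
  ring

lemma OmegaXi_add_sub (p : Params) (ht0 : p.t0 ≠ 0)
    (lam mu dlam dmu : ℂ → ℂ) (σ : ℝ) (δ : ℂ) :
    OmegaXi p (fun t => lam t + dlam t) (fun t => mu t + dmu t) σ δ - OmegaXi p lam mu σ δ
      = dmu (p.t0 + δ * σ) * dOmegaXiMu p (fun t => (lam t + dlam t + lam t) / 2)
          (fun t => (mu t + dmu t + mu t) / 2) dlam (δ * σ)
        + dlam (p.t0 + δ * σ) * dOmegaXiLam p (fun t => (lam t + dlam t + lam t) / 2)
          (fun t => (mu t + dmu t + mu t) / 2) dmu (δ * σ) := by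
  simp only [OmegaXi, dOmegaXiMu, dOmegaXiLam]
  field_simp
  ring

lemma continuous_OmegaMu (p : Params) (hlam : Continuous lam) (hmu : Continuous mu) (δ : ℂ) :
    Continuous fun σ : ℝ => OmegaMu p lam mu σ δ := by
  unfold OmegaMu
  fun_prop

lemma muMap_add (p : Params) (hlam : Continuous lam) (hmu : Continuous mu)
    (hdlam : Continuous dlam) (hdmu : Continuous dmu) (t : ℂ) :
    muMap p (fun t => lam t + dlam t) (fun t => mu t + dmu t) t
      = muMap p lam mu t + nextDmu p (fun t => (lam t + dlam t + lam t) / 2)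
        (fun t => (mu t + dmu t + mu t) / 2) dlam dmu t := by
  simp only [muMap, nextDmu, ← OmegaMu_add_sub]
  rw [intervalIntegral.integral_sub
    ((continuous_OmegaMu p (lam := fun t => lam t + dlam t) (mu := fun t => mu t + dmu t)
      (hlam.add hdlam) (hmu.add hdmu) _).intervalIntegrable _ _)
    ((continuous_OmegaMu p hlam hmu _).intervalIntegrable _ _)]
  ring

lemma lamMap_add (p : Params) (ht0 : p.t0 ≠ 0)
    (hlam : Continuous lam) (hmu : Continuous mu)
    (hdlam : Continuous dlam) (hdmu : Continuous dmu) (t : ℂ) :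
    lamMap p (fun t => lam t + dlam t) (fun t => mu t + dmu t) t
      = lamMap p lam mu t + nextDlam p (fun t => (lam t + dlam t + lam t) / 2)
        (fun t => (mu t + dmu t + mu t) / 2) dlam dmu t := by
  have hlam' : Continuous fun t => lam t + dlam t := hlam.add hdlam
  have hmu' : Continuous fun t => mu t + dmu t := hmu.add hdmu
  have hmuC := continuous_OmegaMu p hlam' hmu' (t - p.t0)
  have hmuC' := continuous_OmegaMu p hlam hmu (t - p.t0)
  have hxi : ∀ {l m : ℂ → ℂ}, Continuous l → Continuous m →
      Continuous fun σ : ℝ => (σ : ℂ) ^ 3 * OmegaXi p l m σ (t - p.t0) := by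
    intro l m hl hm
    unfold OmegaXi
    fun_prop
  have hxiC := hxi hlam' hmu'
  have hxiC' := hxi hlam hmu
  have split : ∀ {l m : ℂ → ℂ}, Continuous (fun σ : ℝ => OmegaMu p l m σ (t - p.t0)) →
      Continuous (fun σ : ℝ => (σ : ℂ) ^ 3 * OmegaXi p l m σ (t - p.t0)) →
      ∫ σ in (0 : ℝ)..1, OmegaLamArc p l m σ (t - p.t0)
        = 2 * (∫ σ in (0 : ℝ)..1, OmegaMu p l m σ (t - p.t0))
          + ∫ σ in (0 : ℝ)..1, (σ : ℂ) ^ 3 * OmegaXi p l m σ (t - p.t0) := by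
    intro l m h h'
    have h2 : Continuous fun σ : ℝ => 2 * OmegaMu p l m σ (t - p.t0) := continuous_const.mul h
    simp only [OmegaLamArc]
    rw [intervalIntegral.integral_add (h2.intervalIntegrable _ _)
      (h'.intervalIntegrable _ _), intervalIntegral.integral_const_mul]
  simp only [lamMap, nextDlam, ← OmegaMu_add_sub, ← OmegaXi_add_sub p ht0,
    mul_sub ((_ : ℂ) ^ 3)]
  rw [split hmuC hxiC, split hmuC' hxiC',
    intervalIntegral.integral_sub (hmuC.intervalIntegrable _ _) (hmuC'.intervalIntegrable _ _),
    intervalIntegral.integral_sub (hxiC.intervalIntegrable _ _) (hxiC'.intervalIntegrable _ _)]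
  ring

/-- The iteration is the fixed-point iteration `μ_{n+1} = F(λ_n, μ_n)`, `λ_{n+1} = G(λ_n, μ_{n+1})`
for the right-hand sides `F`, `G` of the two integral equations. For `n = 0` this says that
`λ₁`, `μ₁` are the first iterates of zero. -/
lemma seq_succ_eq_map (p : Params) (ht0 : p.t0 ≠ 0) (hsgn : p.sgn ^ 2 = 1) (n : ℕ) :
    muSeq p (n + 1) = muMap p (lamSeq p n) (muSeq p n) ∧
      lamSeq p (n + 1) = lamMap p (lamSeq p n) (muSeq p (n + 1)) := by
  induction n with
  | zero =>
    have hmu : muSeq p 1 = mu1 p := funext fun t => zero_add _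
    have hlam : lamSeq p 1 = lam1 p := funext fun t => zero_add _
    rw [hmu, hlam]
    exact ⟨funext (mu1_eq_muMap p), funext (lam1_eq_lamMap p ht0 hsgn)⟩
  | succ n ih =>
    obtain ⟨hlam, hmu, hdlam, hdmu⟩ := isPolynomialFun_quad p n
    obtain ⟨-, hmu', -, hdmu'⟩ := isPolynomialFun_quad p (n + 1)
    constructor
    · funext t
      refine .trans ?_ (muMap_add p hlam.continuous hmu.continuous hdlam.continuous
        hdmu.continuous t).symm
      exact congrArg (· + (quad p (n + 1)).dmu t) (congrFun ih.1 t)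
    · funext t
      refine .trans ?_ (lamMap_add p ht0 hlam.continuous hmu'.continuous hdlam.continuous
        hdmu'.continuous t).symm
      exact congrArg (· + (quad p (n + 1)).dlam t) (congrFun ih.2 t)

/-! ### The constants -/

variable {α : ℝ}

lemma mem_disc {a : ℝ} {t : ℂ} : t ∈ disc p a ↔ ‖t - p.t0‖ < ‖p.t0‖ * a := by
  rw [disc, mem_ball_iff_norm]

lemma add_mul_mem_disc {a : ℝ} {t : ℂ} (ht : t ∈ disc p a) {σ : ℝ} (hσ : σ ∈ Set.Icc (0 : ℝ) 1) :
    p.t0 + (t - p.t0) * σ ∈ disc p a := by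
  rw [mem_disc] at ht ⊢
  rw [add_sub_cancel_left, norm_mul, Complex.norm_real, Real.norm_of_nonneg hσ.1]
  exact (mul_le_of_le_one_right (norm_nonneg _) hσ.2).trans_lt ht

lemma disc_mono {a b : ℝ} (h : a ≤ b) : disc p a ⊆ disc p b :=
  Metric.ball_subset_ball (mul_le_mul_of_nonneg_left h (norm_nonneg _))

lemma one_le_Mlam (p : Params) (α : ℝ) : 1 ≤ Mlam p α := le_max_left _ _

lemma one_le_Mmu (p : Params) (α : ℝ) : 1 ≤ Mmu p α := le_max_left _ _

lemma Mlam_pos (p : Params) (α : ℝ) : 0 < Mlam p α := one_pos.trans_le (one_le_Mlam p α)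

lemma Mmu_pos (p : Params) (α : ℝ) : 0 < Mmu p α := one_pos.trans_le (one_le_Mmu p α)

lemma le_sSup_norm_image_disc {f : ℂ → ℂ} (hf : Continuous f) {t : ℂ} (ht : t ∈ disc p α) :
    ‖f t‖ ≤ sSup ((fun t => ‖f t‖) '' disc p α) := by
  refine le_csSup ?_ ⟨t, ht, rfl⟩
  exact ((isCompact_closedBall p.t0 (‖p.t0‖ * α)).bddAbove_image hf.norm.continuousOn).mono
    (Set.image_mono Metric.ball_subset_closedBall)

lemma norm_lam1_le {t : ℂ} (ht : t ∈ disc p α) : ‖lam1 p t‖ ≤ Mlam p α / 2 := by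
  have := le_sSup_norm_image_disc (isPolynomialFun_lam1 p).continuous ht
  have := le_max_right 1 (2 * sSup ((fun t => ‖lam1 p t‖) '' disc p α))
  rw [Mlam]
  linarith

lemma norm_mu1_le {t : ℂ} (ht : t ∈ disc p α) : ‖mu1 p t‖ ≤ Mmu p α / 2 := by
  have := le_sSup_norm_image_disc (isPolynomialFun_mu1 p).continuous ht
  have := le_max_right 1 (2 * sSup ((fun t => ‖mu1 p t‖) '' disc p α))
  rw [Mmu]
  linarith

/-- A kernel that depends continuously on the values of its function arguments at `t₀ + η` is
bounded by its `kernelBound` as soon as the arguments are within their bounds at that one point,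
because the supremum defining `kernelBound` runs over all constant functions in particular. The
supremum is finite by compactness. -/
lemma norm_le_kernelBound {K : (ℂ → ℂ) → (ℂ → ℂ) → (ℂ → ℂ) → (ℂ → ℂ) → ℂ → ℂ}
    (k : ℂ × ℂ × ℂ × ℂ × ℂ → ℂ) (hk : Continuous k)
    (hK : ∀ lam mu dlam dmu η, K lam mu dlam dmu η
      = k (η, lam (p.t0 + η), mu (p.t0 + η), dlam (p.t0 + η), dmu (p.t0 + η)))
    {η x y u v : ℂ} (hη : ‖η‖ < ‖p.t0‖ * α) (hx : ‖x‖ ≤ Mlam p α) (hy : ‖y‖ ≤ Mmu p α)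
    (hu : ‖u‖ ≤ 2 * Mlam p α) (hv : ‖v‖ ≤ 2 * Mmu p α) :
    ‖k (η, x, y, u, v)‖ ≤ kernelBound p α K := by
  refine le_max_of_le_right (le_csSup ?_ ?_)
  · obtain ⟨C, hC⟩ := IsCompact.exists_bound_of_continuousOn
      ((isCompact_closedBall (0 : ℂ) (‖p.t0‖ * α)).prod <|
        (isCompact_closedBall (0 : ℂ) (Mlam p α)).prod <|
        (isCompact_closedBall (0 : ℂ) (Mmu p α)).prod <|
        (isCompact_closedBall (0 : ℂ) (2 * Mlam p α)).prod <|
        isCompact_closedBall (0 : ℂ) (2 * Mmu p α)) hk.continuousOn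
    refine ⟨C, ?_⟩
    rintro r ⟨lam, mu, dlam, dmu, hlam, hmu, hdlam, hdmu, t, ht, rfl⟩
    rw [hK, add_sub_cancel]
    refine hC _ ⟨?_, ?_, ?_, ?_, ?_⟩
    · exact mem_closedBall_zero_iff.2 (mem_disc.1 ht).le
    · exact mem_closedBall_zero_iff.2 (hlam.2 t ht)
    · exact mem_closedBall_zero_iff.2 (hmu.2 t ht)
    · exact mem_closedBall_zero_iff.2 (hdlam.2 t ht)
    · exact mem_closedBall_zero_iff.2 (hdmu.2 t ht)
  · refine ⟨fun _ => x, fun _ => y, fun _ => u, fun _ => v,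
      ⟨differentiableOn_const _, fun _ _ => hx⟩, ⟨differentiableOn_const _, fun _ _ => hy⟩,
      ⟨differentiableOn_const _, fun _ _ => hu⟩, ⟨differentiableOn_const _, fun _ _ => hv⟩,
      p.t0 + η, ?_, ?_⟩
    · rwa [mem_disc, add_sub_cancel_left]
    · rw [hK, add_sub_cancel_left]

section KernelBounds

variable {η : ℂ}

lemma norm_dOmegaMuLam_le (hη : ‖η‖ < ‖p.t0‖ * α) (hmu : ‖mu (p.t0 + η)‖ ≤ Mmu p α)
    (hdmu : ‖dmu (p.t0 + η)‖ ≤ 2 * Mmu p α) : ‖dOmegaMuLam p mu dmu η‖ ≤ BMuLam p α := by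
  have := Mlam_pos p α
  exact norm_le_kernelBound (K := fun _ mu _ dmu => dOmegaMuLam p mu dmu)
    (fun z => -(z.1 ^ 3 / 2) * ((2 * z.2.2.1 - 1) ^ 2 - 1 + z.2.2.2.2 ^ 2)) (by fun_prop)
    (fun _ _ _ _ _ => rfl) (x := 0) (u := 0) hη (by simp [this.le]) hmu (by simp [this.le]) hdmu

lemma norm_dOmegaMuMu_le (hη : ‖η‖ < ‖p.t0‖ * α) (hlam : ‖lam (p.t0 + η)‖ ≤ Mlam p α)
    (hmu : ‖mu (p.t0 + η)‖ ≤ Mmu p α) : ‖dOmegaMuMu p lam mu η‖ ≤ BMuMu p α := by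
  have h1 := Mlam_pos p α
  have h2 := Mmu_pos p α
  exact norm_le_kernelBound (K := fun lam mu _ _ => dOmegaMuMu p lam mu)
    (fun z => p.sgn * p.chi0 - 2 * z.1 * (2 * z.2.2.1 - 1) *
      (p.sgn - z.1 * (p.chi0 - p.sgn) / (2 * p.t0) + z.1 ^ 2 * z.2.1)) (by fun_prop)
    (fun _ _ _ _ _ => rfl) (u := 0) (v := 0) hη hlam hmu (by simp [h1.le])
    (by simp [h2.le])

lemma norm_dOmegaXiLam_le (hη : ‖η‖ < ‖p.t0‖ * α) (hlam : ‖lam (p.t0 + η)‖ ≤ Mlam p α)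
    (hmu : ‖mu (p.t0 + η)‖ ≤ Mmu p α) (hdmu : ‖dmu (p.t0 + η)‖ ≤ 2 * Mmu p α) :
    ‖dOmegaXiLam p lam mu dmu η‖ ≤ BXiLam p α := by
  have := Mlam_pos p α
  exact norm_le_kernelBound (K := fun lam mu _ dmu => dOmegaXiLam p lam mu dmu)
    (fun z => -3 * p.sgn * p.t0 * (p.chi0 - 2 * p.sgn) + 6 * p.t0 * z.1 * (2 * z.2.2.1 - 1) *
        (p.sgn - z.1 * (p.chi0 - p.sgn) / (2 * p.t0) + z.1 ^ 2 * z.2.1)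
      + 4 * z.1 ^ 3 * (z.2.2.1 * (z.2.2.1 - 1) + z.2.2.2.2 ^ 2 / 4)) (by fun_prop)
    (fun _ _ _ _ _ => rfl) (u := 0) hη hlam hmu (by simp [this.le]) hdmu

lemma norm_dOmegaXiMu_le (hη : ‖η‖ < ‖p.t0‖ * α) (hlam : ‖lam (p.t0 + η)‖ ≤ Mlam p α)
    (hmu : ‖mu (p.t0 + η)‖ ≤ Mmu p α) (hdlam : ‖dlam (p.t0 + η)‖ ≤ 2 * Mlam p α) :
    ‖dOmegaXiMu p lam mu dlam η‖ ≤ BXiMu p α := by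
  have := Mmu_pos p α
  exact norm_le_kernelBound (K := fun lam mu dlam _ => dOmegaXiMu p lam mu dlam)
    (fun z => -8 * p.sgn * p.chi0 + 3 * z.1 * (p.chi0 - p.sgn) ^ 2 / (2 * p.t0)
      + 4 * z.1 * (2 * z.2.2.1 - 1 + 3 * p.t0 * z.2.1) *
        (p.sgn - z.1 * (p.chi0 - p.sgn) / (2 * p.t0) + z.1 ^ 2 * z.2.1)
      - 6 * z.1 ^ 3 * p.t0 * (z.2.1 ^ 2 - z.2.2.2.1 ^ 2 / 4)) (by fun_prop)
    (fun _ _ _ _ _ => rfl) (v := 0) hη hlam hmu hdlam (by simp [this.le])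

end KernelBounds

lemma kernelBound_pos (p : Params) (α : ℝ)
    (K : (ℂ → ℂ) → (ℂ → ℂ) → (ℂ → ℂ) → (ℂ → ℂ) → ℂ → ℂ) : 0 < kernelBound p α K :=
  one_pos.trans_le (le_max_left _ _)

lemma BMuLam_pos (p : Params) (α : ℝ) : 0 < BMuLam p α := kernelBound_pos _ _ _

lemma BMuMu_pos (p : Params) (α : ℝ) : 0 < BMuMu p α := kernelBound_pos _ _ _

lemma BXiLam_pos (p : Params) (α : ℝ) : 0 < BXiLam p α := kernelBound_pos _ _ _

lemma BXiMu_pos (p : Params) (α : ℝ) : 0 < BXiMu p α := kernelBound_pos _ _ _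

lemma Q1_pos (p : Params) (α : ℝ) : 0 < Q1 p α := by
  have := Mlam_pos p α
  have := Mmu_pos p α
  have := BMuLam_pos p α
  have := BMuMu_pos p α
  unfold Q1
  positivity

lemma beta_pos (p : Params) (α : ℝ) : 0 < beta p α := (Q1_pos p α).trans_le (le_max_left _ _)

lemma alphaTilde_pos (p : Params) (hα : 0 < α) : 0 < alphaTilde p α := by
  have := beta_pos p α
  exact lt_min hα (by positivity)

lemma rel_dist_mul_beta_le (ht0 : p.t0 ≠ 0) {t : ℂ} (ht : t ∈ disc p (alphaTilde p α)) :
    ‖t - p.t0‖ / ‖p.t0‖ * beta p α ≤ 1 / 2 := by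
  have hβ := beta_pos p α
  have h0 : 0 < ‖p.t0‖ := norm_pos_iff.2 ht0
  have h : ‖t - p.t0‖ / ‖p.t0‖ ≤ 1 / (2 * beta p α) := by
    rw [div_le_iff₀' h0]
    exact (mem_disc.1 ht).le.trans (mul_le_mul_of_nonneg_left (min_le_right _ _) h0.le)
  calc _ ≤ 1 / (2 * beta p α) * beta p α := mul_le_mul_of_nonneg_right h hβ.le
    _ = 1 / 2 := by field_simp

lemma rel_dist_mul_Q1_le (ht0 : p.t0 ≠ 0) {t : ℂ} (ht : t ∈ disc p (alphaTilde p α)) :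
    ‖t - p.t0‖ / ‖p.t0‖ * Q1 p α ≤ 1 / 2 :=
  (mul_le_mul_of_nonneg_left (le_max_left _ _) (by positivity)).trans (rel_dist_mul_beta_le ht0 ht)

lemma rel_dist_mul_Q2_le (ht0 : p.t0 ≠ 0) {t : ℂ} (ht : t ∈ disc p (alphaTilde p α)) :
    ‖t - p.t0‖ / ‖p.t0‖ * Q2 p α ≤ 1 / 2 :=
  (mul_le_mul_of_nonneg_left (le_max_right _ _) (by positivity)).trans
    (rel_dist_mul_beta_le ht0 ht)

/-! ### Contraction estimates -/

section Contraction

variable {lamHalf muHalf : ℂ → ℂ} {ε : ℝ}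

lemma norm_sub_lt_of_mem {t : ℂ} (ht : t ∈ disc p (alphaTilde p α)) {σ : ℝ}
    (hσ : σ ∈ Set.Icc (0 : ℝ) 1) : ‖(t - p.t0) * σ‖ < ‖p.t0‖ * α := by
  have := mem_disc.1 (disc_mono (min_le_left _ _) (add_mul_mem_disc ht hσ))
  rwa [add_sub_cancel_left] at this

lemma norm_nextDmu_le (hε : ε ≤ 2)
    (hlam : ∀ t ∈ disc p (alphaTilde p α), ‖lamHalf t‖ ≤ Mlam p α)
    (hmu : ∀ t ∈ disc p (alphaTilde p α), ‖muHalf t‖ ≤ Mmu p α)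
    (hdlam : ∀ t ∈ disc p (alphaTilde p α), ‖dlam t‖ ≤ ε * Mlam p α)
    (hdmu : ∀ t ∈ disc p (alphaTilde p α), ‖dmu t‖ ≤ ε * Mmu p α)
    {t : ℂ} (ht : t ∈ disc p (alphaTilde p α)) :
    ‖nextDmu p lamHalf muHalf dlam dmu t‖ ≤ ‖t - p.t0‖ / ‖p.t0‖ * Q1 p α * (ε * Mmu p α) := by
  have hM := Mmu_pos p α
  have hint : ‖∫ σ in (0 : ℝ)..1,
      dmu (p.t0 + (t - p.t0) * σ) * dOmegaMuMu p lamHalf muHalf ((t - p.t0) * σ)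
        + dlam (p.t0 + (t - p.t0) * σ) * dOmegaMuLam p muHalf dmu ((t - p.t0) * σ)‖
      ≤ (ε * Mmu p α * BMuMu p α + ε * Mlam p α * BMuLam p α) * |(1 : ℝ) - 0| := by
    refine intervalIntegral.norm_integral_le_of_norm_le_const fun σ hσ => ?_
    rw [Set.uIoc_of_le zero_le_one] at hσ
    have hσ' := Set.Ioc_subset_Icc_self hσ
    have hτ := add_mul_mem_disc ht hσ'
    have hη := norm_sub_lt_of_mem ht hσ'
    refine (norm_add_le _ _).trans ?_
    rw [norm_mul, norm_mul]
    have h1 := hdmu _ hτ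
    have h2 := hdlam _ hτ
    refine add_le_add
      (mul_le_mul h1 (norm_dOmegaMuMu_le hη (hlam _ hτ) (hmu _ hτ)) (norm_nonneg _)
        ((norm_nonneg _).trans h1))
      (mul_le_mul h2 (norm_dOmegaMuLam_le hη (hmu _ hτ) (h1.trans ?_)) (norm_nonneg _)
        ((norm_nonneg _).trans h2))
    gcongr
  rw [sub_zero, abs_one, mul_one] at hint
  rw [nextDmu, norm_mul, norm_div, mul_assoc]
  refine mul_le_mul_of_nonneg_left ?_ (by positivity)
  calc _ ≤ ε * Mmu p α + (ε * Mmu p α * BMuMu p α + ε * Mlam p α * BMuLam p α) :=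
        (norm_add_le _ _).trans (add_le_add ((norm_neg _).trans_le (hdmu t ht)) hint)
    _ = Q1 p α * (ε * Mmu p α) := by
        rw [Q1]
        field_simp
        ring

/-- The increment of `mu` is at most `ε / 2` times `Mmu`, and because it vanishes linearly at `t₀`,
at most `σ` times this along the ray to `t`. The integrals over `σ` then give
`∫ σ = 1 / 2 ≤ 1 / √3`, `∫ σ ^ 3 = 1 / 4 ≤ 1 / √7` and `∫ σ ^ 4 = 1 / 5 ≤ 1 / 3`, which is why the
factors in `Q2` suffice. Without the linear vanishing the term with `BMuMu` would be too large. -/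
lemma norm_nextDlam_le (ht0 : p.t0 ≠ 0) (hε0 : 0 ≤ ε) (hε : ε ≤ 2)
    (hlam : ∀ t ∈ disc p (alphaTilde p α), ‖lamHalf t‖ ≤ Mlam p α)
    (hmu : ∀ t ∈ disc p (alphaTilde p α), ‖muHalf t‖ ≤ Mmu p α)
    (hdlam : ∀ t ∈ disc p (alphaTilde p α), ‖dlam t‖ ≤ ε * Mlam p α)
    (hdmu : ∀ t ∈ disc p (alphaTilde p α),
      ‖dmu t‖ ≤ ‖t - p.t0‖ / ‖p.t0‖ * Q1 p α * (ε * Mmu p α))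
    {t : ℂ} (ht : t ∈ disc p (alphaTilde p α)) :
    ‖nextDlam p lamHalf muHalf dlam dmu t‖
      ≤ ‖t - p.t0‖ / ‖p.t0‖ * Q2 p α * (ε * Mlam p α) := by
  have hMl := Mlam_pos p α
  have hMm := Mmu_pos p α
  have hB1 := BMuLam_pos p α
  have hB2 := BMuMu_pos p α
  have hB3 := BXiLam_pos p α
  have hB4 := BXiMu_pos p α
  have hT : 0 < ‖p.t0‖ := norm_pos_iff.2 ht0
  have hdmuσ : ∀ σ ∈ Set.Icc (0 : ℝ) 1,
      ‖dmu (p.t0 + (t - p.t0) * σ)‖ ≤ σ * (ε * Mmu p α / 2) := by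
    intro σ hσ
    refine (hdmu _ (add_mul_mem_disc ht hσ)).trans ?_
    rw [add_sub_cancel_left, norm_mul, Complex.norm_real, Real.norm_of_nonneg hσ.1]
    calc _ = σ * (ε * Mmu p α) * (‖t - p.t0‖ / ‖p.t0‖ * Q1 p α) := by ring
      _ ≤ σ * (ε * Mmu p α) * (1 / 2) := by
          have := hσ.1
          exact mul_le_mul_of_nonneg_left (rel_dist_mul_Q1_le ht0 ht) (by positivity)
      _ = _ := by ring
  have hdmu2 : ∀ σ ∈ Set.Icc (0 : ℝ) 1,
      ‖dmu (p.t0 + (t - p.t0) * σ)‖ ≤ 2 * Mmu p α := by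
    intro σ hσ
    refine (hdmuσ σ hσ).trans ?_
    calc σ * (ε * Mmu p α / 2) ≤ 1 * (2 * Mmu p α / 2) := by
          gcongr
          exact hσ.2
      _ ≤ 2 * Mmu p α := by linarith
  have hint1 : ‖∫ σ in (0 : ℝ)..1,
      dmu (p.t0 + (t - p.t0) * σ) * dOmegaMuMu p lamHalf muHalf ((t - p.t0) * σ)
        + dlam (p.t0 + (t - p.t0) * σ) * dOmegaMuLam p muHalf dmu ((t - p.t0) * σ)‖
      ≤ ∫ σ in (0 : ℝ)..1,
        (ε * Mmu p α / 2 * BMuMu p α * σ ^ 1 + ε * Mlam p α * BMuLam p α * σ ^ 0) := by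
    refine intervalIntegral.norm_integral_le_of_norm_le zero_le_one
      (Filter.Eventually.of_forall fun σ hσ => ?_)
      ((by fun_prop : Continuous fun σ : ℝ => _).intervalIntegrable _ _)
    have hσ' := Set.Ioc_subset_Icc_self hσ
    have hτ := add_mul_mem_disc ht hσ'
    have hη := norm_sub_lt_of_mem ht hσ'
    refine (norm_add_le _ _).trans ?_
    rw [norm_mul, norm_mul]
    have h1 := hdmuσ σ hσ'
    have h2 := hdlam _ hτ
    calc _ ≤ σ * (ε * Mmu p α / 2) * BMuMu p α + ε * Mlam p α * BMuLam p α := by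
          refine add_le_add
            (mul_le_mul h1 (norm_dOmegaMuMu_le hη (hlam _ hτ) (hmu _ hτ)) (norm_nonneg _)
              ((norm_nonneg _).trans h1))
            (mul_le_mul h2 (norm_dOmegaMuLam_le hη (hmu _ hτ) (hdmu2 σ hσ')) (norm_nonneg _)
              ((norm_nonneg _).trans h2))
      _ = _ := by ring
  have hint2 : ‖∫ σ in (0 : ℝ)..1, (σ : ℂ) ^ 3 *
      (dmu (p.t0 + (t - p.t0) * σ) * dOmegaXiMu p lamHalf muHalf dlam ((t - p.t0) * σ)
        + dlam (p.t0 + (t - p.t0) * σ) * dOmegaXiLam p lamHalf muHalf dmu ((t - p.t0) * σ))‖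
      ≤ ∫ σ in (0 : ℝ)..1,
        (ε * Mmu p α / 2 * BXiMu p α * σ ^ 4 + ε * Mlam p α * BXiLam p α * σ ^ 3) := by
    refine intervalIntegral.norm_integral_le_of_norm_le zero_le_one
      (Filter.Eventually.of_forall fun σ hσ => ?_)
      ((by fun_prop : Continuous fun σ : ℝ => _).intervalIntegrable _ _)
    have hσ' := Set.Ioc_subset_Icc_self hσ
    have hτ := add_mul_mem_disc ht hσ'
    have hη := norm_sub_lt_of_mem ht hσ'
    have h1 := hdmuσ σ hσ'
    have h2 := hdlam _ hτ
    rw [norm_mul, norm_pow, Complex.norm_real, Real.norm_of_nonneg hσ.1.le]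
    calc _ ≤ σ ^ 3 * (σ * (ε * Mmu p α / 2) * BXiMu p α + ε * Mlam p α * BXiLam p α) := by
          refine mul_le_mul_of_nonneg_left ?_ (pow_nonneg hσ.1.le 3)
          refine (norm_add_le _ _).trans ?_
          rw [norm_mul, norm_mul]
          refine add_le_add
            (mul_le_mul h1 (norm_dOmegaXiMu_le hη (hlam _ hτ) (hmu _ hτ) (h2.trans ?_))
              (norm_nonneg _) ((norm_nonneg _).trans h1))
            (mul_le_mul h2 (norm_dOmegaXiLam_le hη (hlam _ hτ) (hmu _ hτ) (hdmu2 σ hσ'))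
              (norm_nonneg _) ((norm_nonneg _).trans h2))
          gcongr
      _ = _ := by ring
  have hpoly : ∀ (a b : ℝ) (m n : ℕ), ∫ σ in (0 : ℝ)..1, (a * σ ^ m + b * σ ^ n)
      = a / (m + 1) + b / (n + 1) := by
    intro a b m n
    rw [intervalIntegral.integral_add
      ((by fun_prop : Continuous fun σ : ℝ => a * σ ^ m).intervalIntegrable _ _)
      ((by fun_prop : Continuous fun σ : ℝ => b * σ ^ n).intervalIntegrable _ _)]
    simp [div_eq_mul_inv]
  rw [hpoly] at hint1 hint2
  rw [nextDlam, norm_mul, norm_div, mul_assoc]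
  refine mul_le_mul_of_nonneg_left ?_ (by positivity)
  have h3 : 1 / 2 ≤ 1 / √3 :=
    one_div_le_one_div_of_le (by positivity) (Real.sqrt_le_iff.2 (by norm_num))
  have h7 : 1 / 4 ≤ 1 / √7 :=
    one_div_le_one_div_of_le (by positivity) (Real.sqrt_le_iff.2 (by norm_num))
  have hc1 : ‖2 / (3 * p.t0)‖ = 2 / (3 * ‖p.t0‖) := by simp
  have hc2 : ‖1 / (3 * p.t0)‖ = 1 / (3 * ‖p.t0‖) := by simp
  have hsum := (norm_add₃_le (a := -dlam t)).trans (add_le_add_three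
    ((norm_neg _).trans_le (hdlam t ht))
    ((norm_mul_le _ _).trans (mul_le_mul_of_nonneg_left hint1 (norm_nonneg (2 / (3 * p.t0)))))
    ((norm_mul_le _ _).trans (mul_le_mul_of_nonneg_left hint2 (norm_nonneg (1 / (3 * p.t0))))))
  refine hsum.trans ?_
  rw [hc1, hc2]
  have e : Q2 p α * (ε * Mlam p α) = ε * Mlam p α
      + ε * Mlam p α * BMuLam p α * (2 / (3 * ‖p.t0‖))
      + ε * Mlam p α * BXiLam p α / (3 * ‖p.t0‖) * (1 / √7)
      + ε * Mmu p α * BMuMu p α / (3 * ‖p.t0‖) * (1 / √3)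
      + ε * Mmu p α * BXiMu p α / (18 * ‖p.t0‖) := by
    rw [Q2]
    field_simp
    ring
  have k7 := mul_le_mul_of_nonneg_left h7
    (by positivity : 0 ≤ ε * Mlam p α * BXiLam p α / (3 * ‖p.t0‖))
  have k3 := mul_le_mul_of_nonneg_left h3
    (by positivity : 0 ≤ ε * Mmu p α * BMuMu p α / (3 * ‖p.t0‖))
  have kx : ε * Mmu p α * BXiMu p α / (30 * ‖p.t0‖) ≤ ε * Mmu p α * BXiMu p α / (18 * ‖p.t0‖) := by
    gcongr
    norm_num
  rw [e]
  refine le_trans (le_of_eq ?_) (add_le_add (add_le_add (add_le_add le_rfl k7) k3) kx)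
  push_cast
  field_simp
  ring

end Contraction

/-! ### Bounds along the iteration -/

lemma norm_avg_le {x y : ℂ} {M : ℝ} (hx : ‖x‖ ≤ M) (hy : ‖y‖ ≤ M) : ‖(x + y) / 2‖ ≤ M := by
  rw [norm_div, Complex.norm_ofNat]
  linarith [norm_add_le x y]

/-- The increments halve in each step, and so the iterates stay below `Mlam`, `Mmu`; this in turn
is what makes the kernel bounds applicable in the next step. -/
lemma norm_quad_le (ht0 : p.t0 ≠ 0) (n : ℕ) :
    ∀ t ∈ disc p (alphaTilde p α),
      ‖(quad p n).lam t‖ ≤ (1 - (1 / 2) ^ n) * Mlam p α ∧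
      ‖(quad p n).mu t‖ ≤ (1 - (1 / 2) ^ n) * Mmu p α ∧
      ‖(quad p n).dlam t‖ ≤ (1 / 2) ^ (n + 1) * Mlam p α ∧
      ‖(quad p n).dmu t‖ ≤ (1 / 2) ^ (n + 1) * Mmu p α := by
  have hMl := Mlam_pos p α
  have hMm := Mmu_pos p α
  induction n with
  | zero =>
    intro t ht
    have ht' : t ∈ disc p α := disc_mono (min_le_left _ _) ht
    have h1 := norm_lam1_le ht'
    have h2 := norm_mu1_le ht'
    refine ⟨by simp [quad], by simp [quad], ?_, ?_⟩ <;> simp only [quad] <;> linarith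
  | succ n ih =>
    set ε : ℝ := (1 / 2) ^ (n + 1) with hε
    have hεn : ((1 : ℝ) / 2) ^ n = 2 * ε := by rw [hε, pow_succ]; ring
    have hεn' : ((1 : ℝ) / 2) ^ (n + 1 + 1) = ε / 2 := by rw [hε, pow_succ]; ring
    have hε0 : 0 < ε := by positivity
    have hε1 : ε ≤ 1 := pow_le_one₀ (by norm_num) (by norm_num)
    have hεl := mul_pos hε0 hMl
    have hεm := mul_pos hε0 hMm
    rw [hεn']
    rw [hεn] at ih
    have hlamN : ∀ t ∈ disc p (alphaTilde p α),
        ‖(quad p (n + 1)).lam t‖ ≤ (1 - ε) * Mlam p α := by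
      intro t ht
      refine (norm_add_le _ _).trans ?_
      linarith [(ih t ht).1, (ih t ht).2.2.1]
    have hmuN : ∀ t ∈ disc p (alphaTilde p α),
        ‖(quad p (n + 1)).mu t‖ ≤ (1 - ε) * Mmu p α := by
      intro t ht
      refine (norm_add_le _ _).trans ?_
      linarith [(ih t ht).2.1, (ih t ht).2.2.2]
    have hmuN' : ∀ t ∈ disc p (alphaTilde p α), ‖(quad p (n + 1)).mu t‖ ≤ Mmu p α := fun t ht =>
      (hmuN t ht).trans (by linarith)
    have hlamHalf : ∀ t ∈ disc p (alphaTilde p α),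
        ‖((quad p (n + 1)).lam t + (quad p n).lam t) / 2‖ ≤ Mlam p α := fun t ht =>
      norm_avg_le (by linarith [hlamN t ht]) (by linarith [(ih t ht).1])
    have hdmu' : ∀ t ∈ disc p (alphaTilde p α), ‖(quad p (n + 1)).dmu t‖
        ≤ ‖t - p.t0‖ / ‖p.t0‖ * Q1 p α * (ε * Mmu p α) := fun t ht =>
      norm_nextDmu_le (by linarith) hlamHalf
        (fun t ht => norm_avg_le (hmuN' t ht) (by linarith [(ih t ht).2.1]))
        (fun t ht => (ih t ht).2.2.1) (fun t ht => (ih t ht).2.2.2) ht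
    have hdmu : ∀ t ∈ disc p (alphaTilde p α),
        ‖(quad p (n + 1)).dmu t‖ ≤ ε / 2 * Mmu p α := by
      intro t ht
      refine (hdmu' t ht).trans ?_
      have := mul_le_mul_of_nonneg_right (rel_dist_mul_Q1_le ht0 ht) hεm.le
      linarith
    have hdlam' : ∀ t ∈ disc p (alphaTilde p α), ‖(quad p (n + 1)).dlam t‖
        ≤ ‖t - p.t0‖ / ‖p.t0‖ * Q2 p α * (ε * Mlam p α) := fun t ht =>
      norm_nextDlam_le ht0 hε0.le (by linarith) hlamHalf
        (fun t ht => norm_avg_le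
          ((norm_add_le _ _).trans
            ((add_le_add (hmuN t ht) (hdmu t ht)).trans (by linarith))) (hmuN' t ht))
        (fun t ht => (ih t ht).2.2.1) hdmu' ht
    intro t ht
    refine ⟨hlamN t ht, hmuN t ht, (hdlam' t ht).trans ?_, hdmu t ht⟩
    have := mul_le_mul_of_nonneg_right (rel_dist_mul_Q2_le ht0 ht) hεl.le
    linarith

/-! ### Passage to the limit -/

/-- A sequence of partial sums with geometrically bounded increments converges uniformly. -/
lemma exists_tendstoUniformlyOn_of_geometric {f : ℕ → ℂ → ℂ} {g : ℕ → ℂ → ℂ} {s : Set ℂ} {M : ℝ}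
    (h0 : ∀ t, f 0 t = 0) (hf : ∀ n t, f (n + 1) t = f n t + g n t)
    (hg : ∀ n, ∀ t ∈ s, ‖g n t‖ ≤ (1 / 2) ^ (n + 1) * M) :
    ∃ F : ℂ → ℂ, TendstoUniformlyOn f F Filter.atTop s := by
  have hsum : Summable fun n : ℕ => ((1 : ℝ) / 2) ^ (n + 1) * M :=
    ((summable_nat_add_iff 1).2 summable_geometric_two).mul_right M
  refine ⟨_, (tendstoUniformlyOn_tsum_nat hsum hg).congr (.of_forall fun n t _ => ?_)⟩
  induction n with
  | zero => simp [h0]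
  | succ n ih => simp only [Finset.sum_range_succ, hf, ← ih]

lemma tendsto_integral_kernel (k : ℂ × ℂ × ℂ → ℂ) (hk : Continuous k)
    {f g : ℕ → ℂ → ℂ} {F G : ℂ → ℂ} {a M N : ℝ}
    (hf : ∀ n, Continuous (f n)) (hg : ∀ n, Continuous (g n))
    (hfM : ∀ n, ∀ t ∈ disc p a, ‖f n t‖ ≤ M) (hgN : ∀ n, ∀ t ∈ disc p a, ‖g n t‖ ≤ N)
    (hfF : ∀ t ∈ disc p a, Filter.Tendsto (fun n => f n t) Filter.atTop (nhds (F t)))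
    (hgG : ∀ t ∈ disc p a, Filter.Tendsto (fun n => g n t) Filter.atTop (nhds (G t)))
    {t : ℂ} (ht : t ∈ disc p a) :
    Filter.Tendsto
      (fun n => ∫ σ in (0 : ℝ)..1,
        k (σ, f n (p.t0 + (t - p.t0) * σ), g n (p.t0 + (t - p.t0) * σ)))
      Filter.atTop
      (nhds (∫ σ in (0 : ℝ)..1,
        k (σ, F (p.t0 + (t - p.t0) * σ), G (p.t0 + (t - p.t0) * σ)))) := by
  obtain ⟨C, hC⟩ := IsCompact.exists_bound_of_continuousOn
    ((isCompact_closedBall (0 : ℂ) 1).prod <|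
      (isCompact_closedBall (0 : ℂ) M).prod <| isCompact_closedBall (0 : ℂ) N) hk.continuousOn
  have hmem : ∀ σ ∈ Set.uIoc (0 : ℝ) 1, σ ∈ Set.Icc (0 : ℝ) 1 := by
    intro σ hσ
    rw [Set.uIoc_of_le zero_le_one] at hσ
    exact Set.Ioc_subset_Icc_self hσ
  refine intervalIntegral.tendsto_integral_filter_of_dominated_convergence (fun _ => C)
    (.of_forall fun n => ?_) (.of_forall fun n => .of_forall fun σ hσ => ?_)
    intervalIntegrable_const (.of_forall fun σ hσ => ?_)
  · have := hf n
    have := hg n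
    exact (by fun_prop : Continuous fun σ : ℝ =>
      k (σ, f n (p.t0 + (t - p.t0) * σ), g n (p.t0 + (t - p.t0) * σ))).aestronglyMeasurable
  · have hτ := add_mul_mem_disc ht (hmem σ hσ)
    refine hC _ ⟨?_, mem_closedBall_zero_iff.2 (hfM n _ hτ),
      mem_closedBall_zero_iff.2 (hgN n _ hτ)⟩
    rw [mem_closedBall_zero_iff, Complex.norm_real, Real.norm_of_nonneg (hmem σ hσ).1]
    exact (hmem σ hσ).2
  · have hτ := add_mul_mem_disc ht (hmem σ hσ)
    exact (hk.tendsto _).comp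
      (tendsto_const_nhds.prodMk_nhds ((hfF _ hτ).prodMk_nhds (hgG _ hτ)))

section Limit

variable {f g : ℕ → ℂ → ℂ} {F G : ℂ → ℂ} {a M N : ℝ}

lemma tendsto_muMap
    (hf : ∀ n, Continuous (f n)) (hg : ∀ n, Continuous (g n))
    (hfM : ∀ n, ∀ t ∈ disc p a, ‖f n t‖ ≤ M) (hgN : ∀ n, ∀ t ∈ disc p a, ‖g n t‖ ≤ N)
    (hfF : ∀ t ∈ disc p a, Filter.Tendsto (fun n => f n t) Filter.atTop (nhds (F t)))
    (hgG : ∀ t ∈ disc p a, Filter.Tendsto (fun n => g n t) Filter.atTop (nhds (G t)))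
    {t : ℂ} (ht : t ∈ disc p a) :
    Filter.Tendsto (fun n => muMap p (f n) (g n) t) Filter.atTop (nhds (muMap p F G t)) := by
  refine tendsto_const_nhds.add (tendsto_const_nhds.mul
    ((tendsto_const_nhds.sub (hgG t ht)).add ?_))
  -- The factor `σ` is put inside `δt`, with `1` in place of `σ`, to have a kernel on `ℂ³`.
  have h := tendsto_integral_kernel
    (fun z => OmegaMu p (fun _ => z.2.1) (fun _ => z.2.2) 1 ((t - p.t0) * z.1))
    (by unfold OmegaMu; fun_prop) hf hg hfM hgN hfF hgG ht
  simpa only [OmegaMu, Complex.ofReal_one, mul_one] using h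

lemma tendsto_lamMap
    (hf : ∀ n, Continuous (f n)) (hg : ∀ n, Continuous (g n))
    (hfM : ∀ n, ∀ t ∈ disc p a, ‖f n t‖ ≤ M) (hgN : ∀ n, ∀ t ∈ disc p a, ‖g n t‖ ≤ N)
    (hfF : ∀ t ∈ disc p a, Filter.Tendsto (fun n => f n t) Filter.atTop (nhds (F t)))
    (hgG : ∀ t ∈ disc p a, Filter.Tendsto (fun n => g n t) Filter.atTop (nhds (G t)))
    {t : ℂ} (ht : t ∈ disc p a) :
    Filter.Tendsto (fun n => lamMap p (f n) (g n) t) Filter.atTop (nhds (lamMap p F G t)) := by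
  refine tendsto_const_nhds.sub (tendsto_const_nhds.mul
    ((tendsto_const_nhds.add (hfF t ht)).sub (tendsto_const_nhds.mul ?_)))
  have h := tendsto_integral_kernel
    (fun z => 2 * OmegaMu p (fun _ => z.2.1) (fun _ => z.2.2) 1 ((t - p.t0) * z.1)
      + z.1 ^ 3 * OmegaXi p (fun _ => z.2.1) (fun _ => z.2.2) 1 ((t - p.t0) * z.1))
    (by unfold OmegaMu OmegaXi; fun_prop) hf hg hfM hgN hfF hgG ht
  simpa only [OmegaLamArc, OmegaMu, OmegaXi, Complex.ofReal_one, mul_one] using h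

end Limit

end PainleveRoot

end

open PainleveRoot in
theorem theorem1 (p : PainleveRoot.Params) (ht0 : p.t0 ≠ 0) (hsgn : p.sgn ^ 2 = 1)
    (α : ℝ) (hα0 : 0 < α) (hα1 : α < 1) :
    0 < PainleveRoot.alphaTilde p α ∧
    (∀ n : ℕ,
      PainleveRoot.IsPolynomialFun (PainleveRoot.quad p n).lam ∧
      PainleveRoot.IsPolynomialFun (PainleveRoot.quad p n).mu ∧
      PainleveRoot.IsPolynomialFun (PainleveRoot.quad p n).dlam ∧
      PainleveRoot.IsPolynomialFun (PainleveRoot.quad p n).dmu) ∧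
    ∃ lam mu : ℂ → ℂ,
      TendstoUniformlyOn (PainleveRoot.lamSeq p) lam Filter.atTop
        (PainleveRoot.disc p (PainleveRoot.alphaTilde p α)) ∧
      TendstoUniformlyOn (PainleveRoot.muSeq p) mu Filter.atTop
        (PainleveRoot.disc p (PainleveRoot.alphaTilde p α)) ∧
      DifferentiableOn ℂ lam (PainleveRoot.disc p (PainleveRoot.alphaTilde p α)) ∧
      DifferentiableOn ℂ mu (PainleveRoot.disc p (PainleveRoot.alphaTilde p α)) ∧
      ∀ t ∈ PainleveRoot.disc p (PainleveRoot.alphaTilde p α),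
        PainleveRoot.MuEquation p lam mu t ∧ PainleveRoot.LamEquation p lam mu t := by
  have hpos := alphaTilde_pos p hα0
  have hpoly := isPolynomialFun_quad p
  have hbound := norm_quad_le (α := α) ht0
  have hopen : IsOpen (disc p (alphaTilde p α)) := Metric.isOpen_ball
  have hMl := Mlam_pos p α
  have hMm := Mmu_pos p α
  have hcontr : ∀ n : ℕ, (1 : ℝ) - (1 / 2) ^ n ≤ 1 := fun n => sub_le_self _ (by positivity)
  have hlamM : ∀ n, ∀ t ∈ disc p (alphaTilde p α), ‖lamSeq p n t‖ ≤ Mlam p α := fun n t ht =>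
    (hbound n t ht).1.trans (mul_le_of_le_one_left hMl.le (hcontr n))
  have hmuM : ∀ n, ∀ t ∈ disc p (alphaTilde p α), ‖muSeq p n t‖ ≤ Mmu p α := fun n t ht =>
    (hbound n t ht).2.1.trans (mul_le_of_le_one_left hMm.le (hcontr n))
  have hlamC : ∀ n, Continuous (lamSeq p n) := fun n => (hpoly n).1.continuous
  have hmuC : ∀ n, Continuous (muSeq p n) := fun n => (hpoly n).2.1.continuous
  obtain ⟨lam, hlam⟩ := exists_tendstoUniformlyOn_of_geometric (f := lamSeq p)
    (fun _ => rfl) (fun _ _ => rfl) (fun n t ht => (hbound n t ht).2.2.1)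
  obtain ⟨mu, hmu⟩ := exists_tendstoUniformlyOn_of_geometric (f := muSeq p)
    (fun _ => rfl) (fun _ _ => rfl) (fun n t ht => (hbound n t ht).2.2.2)
  have hlam' := fun t ht => hlam.tendsto_at (x := t) ht
  have hmu' := fun t ht => hmu.tendsto_at (x := t) ht
  have hseq := seq_succ_eq_map p ht0 hsgn
  -- The right-hand sides of the equations contain `lam p.t0`, in place of which the maps have
  -- `lamIII`.
  have hcenter : lam p.t0 = p.lamIII := by
    have hmem : p.t0 ∈ disc p (alphaTilde p α) :=
      Metric.mem_ball_self (mul_pos (norm_pos_iff.2 ht0) hpos)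
    refine tendsto_nhds_unique ((Filter.tendsto_add_atTop_iff_nat 1).2 (hlam' _ hmem)) ?_
    have h : ∀ n, lamSeq p (n + 1) p.t0 = p.lamIII := fun n => by
      rw [(hseq n).2]
      simp [lamMap]
    simp only [h]
    exact tendsto_const_nhds
  refine ⟨hpos, hpoly, lam, mu, hlam, hmu,
    hlam.tendstoLocallyUniformlyOn.differentiableOn
      (.of_forall fun n => (hpoly n).1.differentiable.differentiableOn) hopen,
    hmu.tendstoLocallyUniformlyOn.differentiableOn
      (.of_forall fun n => (hpoly n).2.1.differentiable.differentiableOn) hopen, fun t ht => ?_⟩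
  have hmuS : ∀ t ∈ disc p (alphaTilde p α),
      Filter.Tendsto (fun n => muSeq p (n + 1) t) Filter.atTop (nhds (mu t)) := fun t ht =>
    (Filter.tendsto_add_atTop_iff_nat 1).2 (hmu' t ht)
  have hlamS : Filter.Tendsto (fun n => lamSeq p (n + 1) t) Filter.atTop (nhds (lam t)) :=
    (Filter.tendsto_add_atTop_iff_nat 1).2 (hlam' t ht)
  constructor
  · rw [MuEquation, hcenter]
    refine tendsto_nhds_unique (hmuS t ht) ?_
    simp only [(hseq _).1]
    exact tendsto_muMap hlamC hmuC hlamM hmuM hlam' hmu' ht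
  · rw [LamEquation, hcenter]
    refine tendsto_nhds_unique hlamS ?_
    simp only [(hseq _).2]
    exact tendsto_lamMap hlamC (fun n => hmuC (n + 1)) hlamM (fun n => hmuM (n + 1)) hlam' hmuS ht
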